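/- Let $q\in(0,1)$. Put $a_0=\frac{1}{q+1}$, $c_0=0$ and, for $n\ge 1$, $$a_n=q^n\frac{(1+q)(1-q^{n+1})}{(1-q^{2n+1})(1+q^{n+1})},\qquad c_n=q^n\frac{(1+q)(1-q^n)}{(1-q^{2n+1})(1+q^n)},$$ and $b_n=1-a_n-c_n$ for $n\ge 0$. Let $(R_n(x;q))_{n\ge 0}$ be the little $q$-Legendre polynomials, given by $R_0=1$, $R_1(x;q)=\frac{1}{a_0}(x-b_0)$ and $R_1R_n=a_nR_{n+1}+b_nR_n+c_nR_{n-1}$ for $n\ge 1$. Let $\mu=\sum_{n=0}^\infty q^n(1-q)\,\delta_{1-q^n}$ be their orthogonalization measure, where $\delta_x$ is the unit point mass at $x$, and let $h(n)=1/\int_{\mathbb R} R_n(x;q)^2\,d\mu(x)$ be the Haar weights. For $p\in\{1,2\}$ and $f:\mathbb N_0\to\mathbb C$ let $\|f\|_p=\left(\sum_{k=0}^\infty |f(k)|^p h(k)\right)^{1/p}$, and for $n\in\mathbb N_0$ let $\alpha_{1-q^n}$ be the character $\alpha_{1-q^n}(k)=R_k(1-q^n;q)$, $k\in\mathbb N_0$.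 Then $\|\alpha_{1-q^n}\|_1$ and $\|\alpha_{1-q^n}\|_2$ are finite for all $n\in\mathbb N_0$, and there is a constant $C>0$ (which may depend on $q$ but not on $n$) such that $$0<\|\alpha_{1-q^n}\|_2^2<\|\alpha_{1-q^n}\|_1<C\,\|\alpha_{1-q^n}\|_2^2\qquad\text{for all } n\in\mathbb N_0.$$ Moreover, with $N=\left\lceil\frac{\log 4}{\log(1/q)}-1\right\rceil$, it is possible to take $$C=\frac{1}{q^N}\left[\frac{1}{1-q}+\frac{1}{1-q^{2N+1}}\sum_{k=1}^\infty 4^k q^{\frac{(2N+k-1)k}{2}}\right],$$ where the series converges. -/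

import Mathlib

open Polynomial

noncomputable section

/-- The polynomials `P₀ = 1`, `P₁ = (X - b₀) / a₀`,
`P₁ Pₙ = aₙ Pₙ₊₁ + bₙ Pₙ + cₙ Pₙ₋₁` (`n ≥ 1`), for `aₙ ≠ 0`. -/
def recPoly (a b c : ℕ → ℝ) : ℕ → ℝ[X]
  | 0 => 1
  | 1 => C (1 / a 0) * (X - C (b 0))
  | n + 2 =>
      C (1 / a (n + 1)) *
        ((C (1 / a 0) * (X - C (b 0)) - C (b (n + 1))) * recPoly a b c (n + 1)
          - C (c (n + 1)) * recPoly a b c n)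

namespace LittleQLegendre

/-- The recurrence coefficients `aₙ`. -/
def a (q : ℝ) (n : ℕ) : ℝ :=
  if n = 0 then 1 / (q + 1)
  else q ^ n * ((1 + q) * (1 - q ^ (n + 1))) / ((1 - q ^ (2 * n + 1)) * (1 + q ^ (n + 1)))

/-- The recurrence coefficients `cₙ`, with the convention `c₀ = 0`. -/
def c (q : ℝ) (n : ℕ) : ℝ :=
  if n = 0 then 0
  else q ^ n * ((1 + q) * (1 - q ^ n)) / ((1 - q ^ (2 * n + 1)) * (1 + q ^ n))

/-- The recurrence coefficients `bₙ = 1 - aₙ - cₙ`. -/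
def b (q : ℝ) (n : ℕ) : ℝ := 1 - a q n - c q n

/-- The little `q`-Legendre polynomials `Rₙ(x; q)`, normalized by `Rₙ(1; q) = 1`. -/
def R (q : ℝ) (n : ℕ) : ℝ[X] := recPoly (a q) (b q) (c q) n

/-- The orthogonalization measure: mass `qⁿ (1 - q)` at the point `1 - qⁿ`, `n = 0, 1, 2, …`. -/
def orthMeasure (q : ℝ) : MeasureTheory.Measure ℝ :=
  MeasureTheory.Measure.sum fun n : ℕ =>
    ENNReal.ofReal (q ^ n * (1 - q)) • MeasureTheory.Measure.dirac (1 - q ^ n)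

/-- The Haar weights `h(n) = 1 / ∫ Rₙ(x; q)² dμ(x)`. -/
def h (q : ℝ) (n : ℕ) : ℝ := 1 / ∫ x, ((R q n).eval x) ^ 2 ∂(orthMeasure q)

/-- The character `α_z : n ↦ Rₙ(z; q)`. -/
def character (q : ℝ) (z : ℂ) (n : ℕ) : ℂ := aeval z (R q n)

/-- Membership in `ℓᵖ(h)`, i.e. `∑ |f(k)|ᵖ h(k) < ∞`. -/
def MemEllP (q p : ℝ) (f : ℕ → ℂ) : Prop := Summable fun k => ‖f k‖ ^ p * h q k

/-- The norm of `ℓᵖ(h)`, i.e. `(∑ |f(k)|ᵖ h(k)) ^ (1 / p)`. -/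
def normP (q p : ℝ) (f : ℕ → ℂ) : ℝ := (∑' k, ‖f k‖ ^ p * h q k) ^ (1 / p)

/-- `N = ⌈log 4 / log (1 / q) - 1⌉`. -/
def N (q : ℝ) : ℤ := ⌈Real.log 4 / Real.log (1 / q) - 1⌉

/-- The term `4ᵏ q ^ ((2 N + k - 1) k / 2)` of the series in the explicit constant. -/
def seriesTerm (q : ℝ) (k : ℕ) : ℝ :=
  4 ^ k * q ^ ((2 * (N q : ℝ) + (k : ℝ) - 1) * (k : ℝ) / 2)

/-- The explicit constant; the sum runs over `k ≥ 1`. -/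
def explicitConst (q : ℝ) : ℝ :=
  1 / q ^ N q * (1 / (1 - q) + 1 / (1 - q ^ (2 * N q + 1)) * ∑' k : ℕ, seriesTerm q (k + 1))

end LittleQLegendre

end

/-! Write `val q k x` for `R_k(1 - x)`, so the support points become `x = q^n`. The recurrence in
`k` symmetrizes (`val_rec`) with weights `wt q k = q^{-k}(1 - q^{2k+1})`. The hypergeometric form
gives a second-order `q`-difference equation in `x` (`val_qdiff`), that is, a recurrence in `n`.
Playing the two against each other yields orthogonality, hence `h = wt / (1 - q)` (`h_eq`), and dual
orthogonality, hence `‖α‖_2^2 = q^{-n} / (1 - q)` (`hasSum_wt_val_sq`).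

The bound `|R_k(1 - q^m)| ≤ 1` (`abs_val_pow_le_one`) comes from a sum of squares dominating `R_k^2`
that increases in `m` to the limit 1. It gives `‖α‖_2^2 ≤ ‖α‖_1`, strictly because some value is
nonzero of modulus below 1.

For the upper bound the `ℓ^1` sum is split at `k = n + N`. The head is at most the sum of the
weights, of order `q^{-(n+N)}`. In the tail `4 q^k ≤ q^n`, and the recurrence, its growing solutions
excluded by decay, forces `|R_k|` to shrink by a factor of about `4 q^k / q^n` at each step
(`one_sub_mul_abs_val_succ_le`). This produces the series in the constant. -/

namespace LittleQLegendre

/-! ### Coefficients of the basic hypergeometric series -/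

/-- The finite `q`-shifted factorial `(a; q)_j`. -/
noncomputable def qPoch (q a : ℝ) (j : ℕ) : ℝ := ∏ i ∈ Finset.range j, (1 - a * q ^ i)

theorem qPoch_zero (q a : ℝ) : qPoch q a 0 = 1 := by simp [qPoch]

theorem qPoch_succ (q a : ℝ) (j : ℕ) : qPoch q a (j + 1) = qPoch q a j * (1 - a * q ^ j) :=
  Finset.prod_range_succ _ _

theorem qPoch_succ' (q a : ℝ) (j : ℕ) : qPoch q a (j + 1) = (1 - a) * qPoch q (q * a) j := by
  rw [qPoch, Finset.prod_range_succ', qPoch, mul_comm]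
  simp only [pow_zero, mul_one]
  congr 1
  refine Finset.prod_congr rfl fun i _ => ?_
  ring

theorem qPoch_self_pos {q : ℝ} (hq0 : 0 < q) (hq1 : q < 1) (j : ℕ) : 0 < qPoch q q j := by
  refine Finset.prod_pos fun i _ => ?_
  have : q ^ (i + 1) < 1 := pow_lt_one₀ hq0.le hq1 (by simp)
  rw [pow_succ'] at this
  linarith

/-- The coefficients of `₂φ₁(ζ⁻¹, qζ; q; q, qx)`. -/
noncomputable def hyperCoeff (q ζ : ℝ) (j : ℕ) : ℝ :=
  qPoch q ζ⁻¹ j * qPoch q (q * ζ) j * q ^ j / qPoch q q j ^ 2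

theorem hyperCoeff_zero (q ζ : ℝ) : hyperCoeff q ζ 0 = 1 := by simp [hyperCoeff, qPoch_zero]

theorem hyperCoeff_succ {q : ℝ} (hq0 : 0 < q) (hq1 : q < 1) (ζ : ℝ) (j : ℕ) :
    hyperCoeff q ζ (j + 1) * (1 - q ^ (j + 1)) ^ 2 =
      hyperCoeff q ζ j * (q * (1 - ζ⁻¹ * q ^ j) * (1 - q * ζ * q ^ j)) := by
  have h1 := (qPoch_self_pos hq0 hq1 j).ne'
  obtain ⟨D, hD⟩ : ∃ D, D = 1 - q * q ^ j := ⟨_, rfl⟩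
  have h2 : D ≠ 0 := by
    have : q ^ (j + 1) < 1 := pow_lt_one₀ hq0.le hq1 (by simp)
    rw [pow_succ'] at this
    linarith
  simp only [hyperCoeff, qPoch_succ, pow_succ', ← hD]
  field_simp

/-- Coefficientwise three-term recurrence in the degree: for `ζ = q^k`, the shifts `qζ` and `ζ/q`
are the neighbouring degrees. After common factors are split off, it is a rational identity. -/
theorem hyperCoeff_rec_succ {q : ℝ} (hq0 : 0 < q) (hq1 : q < 1) {ζ : ℝ} (hζ : 0 < ζ) (j : ℕ) :
    (1 - q * ζ) / (1 + q * ζ) * (hyperCoeff q (q * ζ) (j + 1) - hyperCoeff q ζ (j + 1)) +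
      (1 - ζ) / (1 + ζ) * (hyperCoeff q (ζ / q) (j + 1) - hyperCoeff q ζ (j + 1)) =
      -(ζ⁻¹ * (1 - q * ζ ^ 2)) * hyperCoeff q ζ j := by
  have hq : q ≠ 0 := hq0.ne'
  have hz : ζ ≠ 0 := hζ.ne'
  have e1 : q * (q * ζ)⁻¹ = ζ⁻¹ := by field_simp
  have e2 : q * (ζ / q) = ζ := by field_simp
  have e3 : (ζ / q)⁻¹ = q * ζ⁻¹ := by field_simp
  have hA : (1 : ℝ) + q * ζ ≠ 0 := by positivity
  have hB : (1 : ℝ) + ζ ≠ 0 := by positivity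
  rcases j with _ | j
  · have h2 : (1 : ℝ) - q ≠ 0 := by linarith
    simp only [hyperCoeff, qPoch_succ, qPoch_zero, e2, e3, zero_add, pow_one, pow_zero, mul_one,
      one_mul, mul_inv]
    field_simp
    ring
  · have h1 := (qPoch_self_pos hq0 hq1 j).ne'
    -- The denominators stay opaque until `field_simp` has cleared them.
    obtain ⟨D, hD⟩ : ∃ D, D = 1 - q * q ^ j := ⟨_, rfl⟩
    obtain ⟨E, hE⟩ : ∃ E, E = 1 - q * (q * q ^ j) := ⟨_, rfl⟩
    have h2 : D ≠ 0 := by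
      have : q ^ (j + 1) < 1 := pow_lt_one₀ hq0.le hq1 (by simp)
      rw [pow_succ'] at this
      linarith
    have h3 : E ≠ 0 := by
      have : q ^ (j + 2) < 1 := pow_lt_one₀ hq0.le hq1 (by simp)
      rw [pow_succ', pow_succ'] at this
      linarith
    have a1 : qPoch q (q * ζ)⁻¹ (j + 1 + 1) =
        (1 - (q * ζ)⁻¹) * ((1 - ζ⁻¹) * qPoch q (q * ζ⁻¹) j) := by
      rw [qPoch_succ', qPoch_succ', e1]
    have a2 : qPoch q (q * (q * ζ)) (j + 1 + 1) = qPoch q (q * (q * ζ)) j *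
        (1 - q * (q * ζ) * q ^ j) * (1 - q * (q * ζ) * (q * q ^ j)) := by
      rw [qPoch_succ, qPoch_succ, pow_succ']
    have a3 : qPoch q ζ⁻¹ (j + 1 + 1) =
        (1 - ζ⁻¹) * (qPoch q (q * ζ⁻¹) j * (1 - q * ζ⁻¹ * q ^ j)) := by
      rw [qPoch_succ', qPoch_succ]
    have a4 : qPoch q (q * ζ) (j + 1 + 1) =
        (1 - q * ζ) * (qPoch q (q * (q * ζ)) j * (1 - q * (q * ζ) * q ^ j)) := by
      rw [qPoch_succ', qPoch_succ]
    have a5 : qPoch q (q * ζ⁻¹) (j + 1 + 1) = qPoch q (q * ζ⁻¹) j *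
        (1 - q * ζ⁻¹ * q ^ j) * (1 - q * ζ⁻¹ * (q * q ^ j)) := by
      rw [qPoch_succ, qPoch_succ, pow_succ']
    have a6 : qPoch q ζ (j + 1 + 1) = (1 - ζ) * ((1 - q * ζ) * qPoch q (q * (q * ζ)) j) := by
      rw [qPoch_succ', qPoch_succ']
    have a7 : qPoch q ζ⁻¹ (j + 1) = (1 - ζ⁻¹) * qPoch q (q * ζ⁻¹) j := qPoch_succ' _ _ _
    have a8 : qPoch q (q * ζ) (j + 1) = (1 - q * ζ) * qPoch q (q * (q * ζ)) j := qPoch_succ' _ _ _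
    have a9 : qPoch q q (j + 1 + 1) = qPoch q q j * D * E := by
      rw [qPoch_succ, qPoch_succ, pow_succ', hD, hE]
    have a10 : qPoch q q (j + 1) = qPoch q q j * D := by
      rw [qPoch_succ, hD]
    simp only [hyperCoeff, e2, e3, a1, a2, a3, a4, a5, a6, a7, a8, a9, a10]
    generalize qPoch q (q * ζ⁻¹) j = M₁
    generalize qPoch q (q * (q * ζ)) j = M₂
    generalize qPoch q q j = M₃ at *
    simp only [pow_succ' q]
    generalize q ^ j = w at *
    field_simp
    subst hD hE
    ring

theorem hyperCoeff_eq_zero {q : ℝ} (hq0 : 0 < q) {k j : ℕ} (h : k < j) :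
    hyperCoeff q (q ^ k) j = 0 := by
  have : qPoch q (q ^ k)⁻¹ j = 0 := by
    refine Finset.prod_eq_zero (Finset.mem_range.2 h) ?_
    rw [inv_mul_cancel₀ (pow_pos hq0 k).ne', sub_self]
  rw [hyperCoeff, this]
  simp

/-! ### Hypergeometric form and the symmetric three-term recurrence -/

/-- The little `q`-Legendre polynomials in hypergeometric form. -/
noncomputable def hyperPoly (q : ℝ) (k : ℕ) : ℝ[X] :=
  ∑ j ∈ Finset.range (k + 1), monomial j (hyperCoeff q (q ^ k) j)

theorem coeff_hyperPoly {q : ℝ} (hq0 : 0 < q) (k j : ℕ) :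
    (hyperPoly q k).coeff j = hyperCoeff q (q ^ k) j := by
  simp only [hyperPoly, finsetSum_coeff, coeff_monomial, Finset.sum_ite_eq', Finset.mem_range]
  split_ifs with h
  · rfl
  · exact (hyperCoeff_eq_zero hq0 (by omega)).symm

theorem natDegree_hyperPoly_le (q : ℝ) (k : ℕ) : (hyperPoly q k).natDegree ≤ k := by
  refine natDegree_sum_le_of_forall_le _ _ fun j hj => ?_
  exact (natDegree_monomial_le _).trans (by simpa [Nat.lt_succ_iff] using hj)

/-- The conductances `(1 - qᵏ) / (1 + qᵏ)` in the symmetric form of the recurrence. -/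
noncomputable def edgeWt (q : ℝ) (k : ℕ) : ℝ := (1 - q ^ k) / (1 + q ^ k)

/-- The unnormalized Haar weights. -/
noncomputable def wt (q : ℝ) (k : ℕ) : ℝ := (q ^ k)⁻¹ * (1 - q ^ (2 * k + 1))

/-- The value of the `k`-th polynomial in the reflected variable. -/
noncomputable def val (q : ℝ) (k : ℕ) (x : ℝ) : ℝ := (R q k).eval (1 - x)

theorem hyperPoly_rec {q : ℝ} (hq0 : 0 < q) (hq1 : q < 1) (k : ℕ) :
    C (edgeWt q (k + 2)) * (hyperPoly q (k + 2) - hyperPoly q (k + 1)) +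
      C (edgeWt q (k + 1)) * (hyperPoly q k - hyperPoly q (k + 1)) =
      C (-wt q (k + 1)) * (X * hyperPoly q (k + 1)) := by
  have e1 : q ^ (k + 2) = q * q ^ (k + 1) := pow_succ' _ _
  have e2 : q ^ k = q ^ (k + 1) / q := by field_simp; ring
  ext j
  simp only [coeff_add, coeff_C_mul, coeff_sub, coeff_hyperPoly hq0]
  rcases j with _ | j
  · simp [hyperCoeff_zero]
  · rw [coeff_X_mul, coeff_hyperPoly hq0]
    have := hyperCoeff_rec_succ hq0 hq1 (pow_pos hq0 (k + 1)) j
    rw [← e2, ← e1] at this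
    rw [edgeWt, edgeWt, wt, this]
    ring

theorem one_sub_pow_pos {q : ℝ} (hq0 : 0 < q) (hq1 : q < 1) (k : ℕ) : 0 < 1 - q ^ (k + 1) :=
  sub_pos.2 (pow_lt_one₀ hq0.le hq1 (by simp))

theorem edgeWt_zero (q : ℝ) : edgeWt q 0 = 0 := by simp [edgeWt]

theorem edgeWt_succ_pos {q : ℝ} (hq0 : 0 < q) (hq1 : q < 1) (k : ℕ) : 0 < edgeWt q (k + 1) :=
  div_pos (one_sub_pow_pos hq0 hq1 k) (by positivity)

theorem wt_pos {q : ℝ} (hq0 : 0 < q) (hq1 : q < 1) (k : ℕ) : 0 < wt q k :=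
  mul_pos (inv_pos.2 (pow_pos hq0 k)) (one_sub_pow_pos hq0 hq1 _)

theorem val_zero (q x : ℝ) : val q 0 x = 1 := by simp [val, R, recPoly]

theorem val_one {q : ℝ} (hq0 : 0 < q) (x : ℝ) : val q 1 x = 1 - (1 + q) * x := by
  have : q + 1 ≠ 0 := by positivity
  simp only [val, R, recPoly, a, b, c, if_true, eval_mul, eval_sub, eval_C, eval_X]
  field_simp
  ring

/-- The coefficients factor as `a_k = (1+q) edgeWt (k+1) / wt k` and `c_k = (1+q) edgeWt k / wt k`,
so multiplying by `wt k` symmetrizes the recurrence. At `k = 0` the truncated index `k - 1` is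
harmless because `edgeWt q 0 = 0`. -/
theorem val_rec {q : ℝ} (hq0 : 0 < q) (hq1 : q < 1) (k : ℕ) (x : ℝ) :
    edgeWt q (k + 1) * val q (k + 1) x + edgeWt q k * val q (k - 1) x =
      (edgeWt q (k + 1) + edgeWt q k - x * wt q k) * val q k x := by
  rcases k with _ | k
  · have : 1 + q ≠ 0 := by positivity
    simp only [zero_add, val_one hq0, val_zero, edgeWt, wt, pow_one, pow_zero]
    field_simp
    ring
  · have hw := wt_pos hq0 hq1 (k + 1)
    have hg := edgeWt_succ_pos hq0 hq1 (k + 1)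
    have hq : q + 1 ≠ 0 := by positivity
    have hd := (one_sub_pow_pos hq0 hq1 (2 * (k + 1))).ne'
    have hz := (pow_pos hq0 (k + 1)).ne'
    have ha : a q (k + 1) = (1 + q) * edgeWt q (k + 1 + 1) / wt q (k + 1) := by
      have : 1 + q ^ (k + 1 + 1) ≠ 0 := by positivity
      rw [a, if_neg (by simp), edgeWt, wt]
      field_simp
    have hc : c q (k + 1) = (1 + q) * edgeWt q (k + 1) / wt q (k + 1) := by
      have : 1 + q ^ (k + 1) ≠ 0 := by positivity
      rw [c, if_neg (by simp), edgeWt, wt]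
      field_simp
    have hb : b q (k + 1) = 1 - a q (k + 1) - c q (k + 1) := rfl
    have hstep : val q (k + 1 + 1) x = 1 / a q (k + 1) *
        ((1 - (1 + q) * x - b q (k + 1)) * val q (k + 1) x - c q (k + 1) * val q k x) := by
      rw [← val_one hq0]
      simp [val, R, recPoly]
    rw [hstep, hb, ha, hc, Nat.add_sub_cancel]
    have := hg.ne'
    have := hw.ne'
    have : 1 + q ≠ 0 := by positivity
    field_simp
    ring

theorem val_eq_eval_hyperPoly {q : ℝ} (hq0 : 0 < q) (hq1 : q < 1) (k : ℕ) (x : ℝ) :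
    val q k x = (hyperPoly q k).eval x := by
  induction k using Nat.strong_induction_on with
  | _ k ih =>
    rcases k with _ | _ | k
    · simp [val_zero, hyperPoly, hyperCoeff_zero]
    · have : (1 : ℝ) - q ≠ 0 := by linarith
      rw [zero_add, val_one hq0]
      simp only [hyperPoly, Finset.sum_range_succ, Finset.sum_range_zero, eval_add,
        eval_monomial, hyperCoeff, qPoch_succ, qPoch_zero, pow_one, pow_zero]
      field_simp
      simp
      ring
    · have h1 := congrArg (eval x) (hyperPoly_rec hq0 hq1 k)
      have h2 := val_rec hq0 hq1 (k + 1) x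
      rw [Nat.add_sub_cancel, ih k (by omega), ih (k + 1) (by omega)] at h2
      simp only [eval_add, eval_sub, eval_mul, eval_C, eval_X] at h1
      refine mul_left_cancel₀ (edgeWt_succ_pos hq0 hq1 (k + 1)).ne' ?_
      linear_combination h2 - h1

/-! ### The `q`-difference equation in the variable -/

theorem hyperPoly_qdiff {q : ℝ} (hq0 : 0 < q) (hq1 : q < 1) (k : ℕ) :
    (1 - C q * X) * (hyperPoly q k - (hyperPoly q k).comp (C q * X)) -
      (1 - X) * ((hyperPoly q k).comp (C q⁻¹ * X) - hyperPoly q k) =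
      C ((q ^ k)⁻¹ + q ^ (k + 1) - 1 - q) * (X * hyperPoly q k) := by
  have hq : q ≠ 0 := hq0.ne'
  ext j
  simp only [sub_mul, one_mul, mul_assoc, coeff_sub, coeff_C_mul]
  rcases j with _ | j
  · simp [comp_C_mul_X_coeff]
  · simp only [coeff_X_mul, comp_C_mul_X_coeff, coeff_hyperPoly hq0, coeff_sub]
    have h := hyperCoeff_succ hq0 hq1 (q ^ k) j
    have hz := (pow_pos hq0 k).ne'
    have hw := (pow_pos hq0 j).ne'
    simp only [pow_succ', inv_pow] at h ⊢
    generalize q ^ k = z at *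
    generalize q ^ j = w at *
    field_simp at h ⊢
    linear_combination (-1) * h

theorem val_qdiff {q : ℝ} (hq0 : 0 < q) (hq1 : q < 1) (k : ℕ) (x : ℝ) :
    (1 - q * x) * (val q k x - val q k (q * x)) - (1 - x) * (val q k (x / q) - val q k x) =
      ((q ^ k)⁻¹ + q ^ (k + 1) - 1 - q) * (x * val q k x) := by
  have := congrArg (eval x) (hyperPoly_qdiff hq0 hq1 k)
  simp only [eval_sub, eval_mul, eval_C, eval_X, eval_comp, eval_one] at this
  simpa only [val_eq_eval_hyperPoly hq0 hq1, div_eq_inv_mul] using this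

/-- The dual recurrence, in the index of the support point. At `m = 0` the term with the truncated
`m - 1` has coefficient zero. -/
theorem val_qdiff_pow {q : ℝ} (hq0 : 0 < q) (hq1 : q < 1) (k m : ℕ) :
    (1 - q ^ (m + 1)) * val q k (q ^ (m + 1)) + (1 - q ^ m) * val q k (q ^ (m - 1)) =
      (2 - q ^ m * ((q ^ k)⁻¹ + q ^ (k + 1))) * val q k (q ^ m) := by
  have h := val_qdiff hq0 hq1 k (q ^ m)
  rcases m with _ | m
  · simp only [zero_add, pow_one, pow_zero, mul_one] at *
    linear_combination -h
  · have e : q ^ (m + 1) / q = q ^ m := by field_simp; ring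
    rw [e, ← pow_succ'] at h
    rw [Nat.add_sub_cancel]
    linear_combination -h

theorem val_at_zero {q : ℝ} (hq0 : 0 < q) (hq1 : q < 1) (k : ℕ) : val q k 0 = 1 := by
  rw [val_eq_eval_hyperPoly hq0 hq1, ← coeff_zero_eq_eval_zero, coeff_hyperPoly hq0,
    hyperCoeff_zero]

theorem continuous_val (q : ℝ) (k : ℕ) : Continuous (val q k) := by
  unfold val
  fun_prop

theorem tendsto_val_pow {q : ℝ} (hq0 : 0 < q) (hq1 : q < 1) (k : ℕ) :
    Filter.Tendsto (fun m : ℕ => val q k (q ^ m)) Filter.atTop (nhds 1) := by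
  rw [← val_at_zero hq0 hq1 k]
  exact ((continuous_val q k).tendsto 0).comp (tendsto_pow_atTop_nhds_zero_of_lt_one hq0.le hq1)

theorem val_at_one {q : ℝ} (hq0 : 0 < q) (hq1 : q < 1) (k : ℕ) :
    val q k 1 = (-1) ^ k * q ^ (k * (k + 1) / 2) := by
  induction k using Nat.strong_induction_on with
  | _ k ih =>
    rcases k with _ | _ | k
    · simp [val_zero]
    · rw [zero_add, val_one hq0]
      norm_num
    · have h := val_rec hq0 hq1 (k + 1) 1
      rw [Nat.add_sub_cancel, ih k (by omega), ih (k + 1) (by omega)] at h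
      have e1 : (k + 1) * (k + 1 + 1) / 2 = k * (k + 1) / 2 + (k + 1) := by
        rw [show (k + 1) * (k + 1 + 1) = k * (k + 1) + (k + 1) * 2 by ring]
        omega
      have e2 : (k + 1 + 1) * (k + 1 + 1 + 1) / 2 = k * (k + 1) / 2 + (k + 1) + (k + 2) := by
        rw [show (k + 1 + 1) * (k + 1 + 1 + 1) = k * (k + 1) + (2 * k + 3) * 2 by ring]
        omega
      refine mul_left_cancel₀ (edgeWt_succ_pos hq0 hq1 (k + 1)).ne' ?_
      rw [eq_sub_of_add_eq h, e1, e2]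
      have h1 : 1 + q ^ (k + 1) ≠ 0 := by positivity
      obtain ⟨D, hD⟩ : ∃ D, D = 1 + q ^ (k + 1 + 1) := ⟨_, rfl⟩
      have h2 : D ≠ 0 := by rw [hD]; positivity
      have hz := (pow_pos hq0 k).ne'
      rw [edgeWt, edgeWt, ← hD]
      simp only [wt, pow_add, pow_mul', pow_one, pow_two] at h1 hz hD ⊢
      generalize q ^ (k * (k + 1) / 2) = A
      generalize q ^ k = z at *
      field_simp
      rw [hD]
      ring

/-! ### Iterated `q`-difference quotients -/

/-- The iterated `q`-difference quotients of a function. -/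
noncomputable def qDiffQuot (q : ℝ) (y : ℝ → ℝ) : ℕ → ℝ → ℝ
  | 0 => y
  | j + 1 => fun x => (qDiffQuot q y j x - qDiffQuot q y j (q * x)) / x

theorem qDiffQuot_succ_mul (q : ℝ) (y : ℝ → ℝ) (j : ℕ) {x : ℝ} (hx : x ≠ 0) :
    x * qDiffQuot q y (j + 1) x = qDiffQuot q y j x - qDiffQuot q y j (q * x) := by
  simp only [qDiffQuot]
  field_simp

/-- The eigenvalues of the difference equations satisfied by the iterated quotients. -/
noncomputable def qEig (q : ℝ) (k j : ℕ) : ℝ := (q ^ k)⁻¹ + q ^ (k + 1) - (q ^ j)⁻¹ - q ^ (j + 1)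

theorem qEig_eq {q : ℝ} (hq0 : 0 < q) (j i : ℕ) :
    qEig q (j + i) j = (q ^ (j + i))⁻¹ * (1 - q ^ i) * (1 - q ^ (2 * j + i + 1)) := by
  have h1 := (pow_pos hq0 j).ne'
  have h2 := (pow_pos hq0 i).ne'
  rw [qEig, show 2 * j + i + 1 = j + j + i + 1 by ring]
  simp only [pow_add]
  field_simp
  ring

theorem qEig_pos {q : ℝ} (hq0 : 0 < q) (hq1 : q < 1) {k j : ℕ} (h : j < k) :
    0 < qEig q k j := by
  obtain ⟨i, rfl⟩ := Nat.exists_eq_add_of_lt h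
  rw [add_assoc, qEig_eq hq0]
  exact mul_pos (mul_pos (inv_pos.2 (pow_pos hq0 _)) (one_sub_pow_pos hq0 hq1 _))
    (one_sub_pow_pos hq0 hq1 _)

/-- Differencing the equation at level `j` between `x` and `qx` gives the one at level `j + 1`, with
a shifted eigenvalue. -/
theorem qDiffQuot_val_qdiff {q : ℝ} (hq0 : 0 < q) (hq1 : q < 1) (k j : ℕ) {x : ℝ} (hx : x ≠ 0) :
    (1 - q ^ (j + 1) * x) * qDiffQuot q (val q k) (j + 1) x -
      (q ^ (j + 1))⁻¹ * (1 - x) * qDiffQuot q (val q k) (j + 1) (x / q) =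
      qEig q k j * qDiffQuot q (val q k) j x := by
  have hq : q ≠ 0 := hq0.ne'
  induction j generalizing x with
  | zero =>
    have h := val_qdiff hq0 hq1 k x
    have e : q * (x / q) = x := by field_simp
    simp only [qDiffQuot, e, qEig, zero_add, pow_one, pow_zero, inv_one]
    field_simp
    field_simp at h
    linear_combination h
  | succ j ih =>
    have hqx : q * x ≠ 0 := mul_ne_zero hq hx
    have h1 := ih hx
    have h2 := ih hqx
    have e : q * x / q = x := by field_simp
    have e' : q * (x / q) = x := by field_simp
    rw [e] at h2
    have d1 := qDiffQuot_succ_mul q (val q k) (j + 1) hx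
    have d2 := qDiffQuot_succ_mul q (val q k) (j + 1) (div_ne_zero hx hq)
    have d3 := qDiffQuot_succ_mul q (val q k) j hx
    rw [e'] at d2
    have hE : qEig q k (j + 1) = qEig q k j + ((q ^ j)⁻¹ + q ^ (j + 1))
        - ((q ^ (j + 1))⁻¹ + q ^ (j + 1 + 1)) := by
      rw [qEig, qEig]
      ring
    rw [hE]
    have hw := (pow_pos hq0 j).ne'
    generalize qDiffQuot q (val q k) (j + 1 + 1) x = U2 at *
    generalize qDiffQuot q (val q k) (j + 1 + 1) (x / q) = V2 at *
    generalize qDiffQuot q (val q k) (j + 1) x = U1 at *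
    generalize qDiffQuot q (val q k) (j + 1) (x / q) = V1 at *
    generalize qDiffQuot q (val q k) (j + 1) (q * x) = W1 at *
    generalize qDiffQuot q (val q k) j x = U0 at *
    generalize qDiffQuot q (val q k) j (q * x) = W0 at *
    generalize qEig q k j = lam at *
    simp only [pow_succ, mul_inv] at *
    generalize q ^ j = w at *
    have d1' : W1 = U1 - x * U2 := by linarith
    have d2' : V1 = U1 + x / q * V2 := by linarith
    have d3' : lam * (x * U1) = lam * U0 - lam * W0 := by rw [d3]; ring
    rw [← h1, ← h2, d1', d2'] at d3'
    field_simp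
    field_simp at d3'
    refine mul_left_cancel₀ hx ?_
    linear_combination (-1) * d3'

/-- The iterated quotients of a polynomial function are polynomial functions. -/
theorem exists_poly_qDiffQuot {q : ℝ} (hq : q ≠ 0) (k : ℕ) (P : ℝ[X]) (hP : P.natDegree ≤ k) (j : ℕ) :
    ∃ Q : ℝ[X], Q.natDegree ≤ k - j ∧
      ∀ x ≠ 0, qDiffQuot q (fun x => P.eval x) j x = Q.eval x := by
  induction j with
  | zero => exact ⟨P, hP, fun x _ => rfl⟩
  | succ j ih =>
    obtain ⟨Q, hQ, hQe⟩ := ih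
    set S := Q - Q.comp (C q * X) with hS
    have h0 : S.coeff 0 = 0 := by simp [hS, comp_C_mul_X_coeff]
    have hdeg : S.natDegree ≤ k - j := by
      refine (natDegree_sub_le_of_le hQ ?_).trans_eq (max_self _)
      refine natDegree_comp_le.trans ?_
      have : (C q * X : ℝ[X]).natDegree ≤ 1 := (natDegree_C_mul_le _ _).trans natDegree_X_le
      nlinarith
    refine ⟨S.divX, ?_, fun x hx => ?_⟩
    · rw [natDegree_divX_eq_natDegree_tsub_one]
      omega
    · have h := congrArg (eval x) (divX_mul_X_add S)
      rw [h0] at h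
      simp only [qDiffQuot]
      rw [hQe x hx, hQe (q * x) (mul_ne_zero hq hx), div_eq_iff hx]
      simp only [C_0, add_zero, eval_mul, eval_X] at h
      rw [h, hS]
      simp

/-- Each quotient lowers the degree by one, so the `k`-th is constant off zero. -/
theorem qDiffQuot_val_vanish {q : ℝ} (hq0 : 0 < q) (hq1 : q < 1) (k : ℕ) {x : ℝ} (hx : x ≠ 0) :
    qDiffQuot q (val q k) (k + 1) x = 0 := by
  obtain ⟨Q, hQ, hQe⟩ :=
    exists_poly_qDiffQuot hq0.ne' k (hyperPoly q k) (natDegree_hyperPoly_le q k) k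
  have hv : (fun x => (hyperPoly q k).eval x) = val q k := by
    ext x
    rw [val_eq_eval_hyperPoly hq0 hq1]
  rw [Nat.sub_self, Nat.le_zero] at hQ
  rw [hv, eq_C_of_natDegree_eq_zero hQ] at hQe
  simp only [qDiffQuot]
  rw [hQe x hx, hQe (q * x) (mul_ne_zero hq0.ne' hx)]
  simp

/-! ### The uniform bound on the support -/

/-- The weighted squares of the iterated quotients (squared entries of the unitary
representations of the quantum group `SU_q(2)`, up to normalization). -/
noncomputable def ladderSq (q : ℝ) (k j : ℕ) (t : ℝ) : ℝ :=
  t ^ j * qPoch q (q * t) j * qDiffQuot q (val q k) j t ^ 2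

/-- The two terms on the right have the same shape at adjacent levels; dividing by the product of
eigenvalues makes them telescope in `j`. -/
theorem ladderSq_sub {q : ℝ} (hq0 : 0 < q) (hq1 : q < 1) (k j : ℕ) {s : ℝ} (hs : s ≠ 0) :
    ladderSq q k (j + 1) s - ladderSq q k (j + 1) (q * s) =
      s ^ (j + 2) * qPoch q (q * s) (j + 1) *
          (qDiffQuot q (val q k) (j + 1) s * qDiffQuot q (val q k) (j + 2) s) -
        qEig q k j * ((q * s) ^ (j + 1) * qPoch q (q * (q * s)) j *
          (qDiffQuot q (val q k) j (q * s) * qDiffQuot q (val q k) (j + 1) (q * s))) := by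
  have hq : q ≠ 0 := hq0.ne'
  have h := qDiffQuot_val_qdiff hq0 hq1 k j (mul_ne_zero hq hs)
  have e : q * s / q = s := by field_simp
  have d := qDiffQuot_succ_mul q (val q k) (j + 1) hs
  rw [e] at h
  have p1 := qPoch_succ q (q * (q * s)) j
  have p2 := qPoch_succ' q (q * s) j
  have hw := (pow_pos hq0 (j + 1)).ne'
  have e1 : (1 - q * (q * s) * q ^ j) = 1 - q ^ (j + 1) * (q * s) := by ring
  rw [ladderSq, ladderSq, p1, p2, e1, pow_succ s (j + 1), mul_pow q s]
  generalize qDiffQuot q (val q k) (j + 1 + 1) s = U2 at *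
  generalize qDiffQuot q (val q k) (j + 1) s = U1 at *
  generalize qDiffQuot q (val q k) (j + 1) (q * s) = W1 at *
  generalize qDiffQuot q (val q k) j (q * s) = W0 at *
  generalize qEig q k j = lam at *
  generalize qPoch q (q * (q * s)) j = M at *
  generalize q ^ (j + 1) = w at *
  generalize s ^ (j + 1) = v at *
  have h' : w * lam * W0 = w * (1 - w * (q * s)) * W1 - (1 - q * s) * U1 := by
    rw [mul_assoc, ← h]
    field_simp
  linear_combination (-v * ((1 - q * s) * M) * U1) * d + v * M * W1 * h'

theorem sum_ladderSq_sub {q : ℝ} (hq0 : 0 < q) (hq1 : q < 1) (k J : ℕ) (hJ : J ≤ k) {x : ℝ}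
    (hx : x ≠ 0) :
    ∑ j ∈ Finset.range J, (∏ i ∈ Finset.range (j + 1), qEig q k i)⁻¹ *
        (ladderSq q k (j + 1) (x / q ^ (j + 1)) - ladderSq q k (j + 1) (q * (x / q ^ (j + 1)))) =
      (∏ i ∈ Finset.range J, qEig q k i)⁻¹ * ((x / q ^ J) ^ (J + 1) *
        qPoch q (q * (x / q ^ J)) J * (qDiffQuot q (val q k) J (x / q ^ J) *
          qDiffQuot q (val q k) (J + 1) (x / q ^ J))) -
      x * (val q k x * qDiffQuot q (val q k) 1 x) := by
  have hq : q ≠ 0 := hq0.ne'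
  induction J with
  | zero => simp [qPoch_zero, qDiffQuot]
  | succ J ih =>
    have e : q * (x / q ^ (J + 1)) = x / q ^ J := by
      rw [pow_succ]
      field_simp
    have hlam := (qEig_pos hq0 hq1 (show J < k by omega)).ne'
    have hprod : ∏ i ∈ Finset.range J, qEig q k i ≠ 0 := Finset.prod_ne_zero_iff.2 fun i hi =>
      (qEig_pos hq0 hq1 (by have := Finset.mem_range.1 hi; omega)).ne'
    rw [Finset.sum_range_succ, ih (by omega),
      ladderSq_sub hq0 hq1 k J (div_ne_zero hx (pow_ne_zero _ hq)), e, Finset.prod_range_succ]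
    field_simp
    ring

/-- The truncated addition formula: a majorant of the square of the polynomial. -/
noncomputable def ladderSum (q : ℝ) (k : ℕ) (x : ℝ) : ℝ :=
  val q k x ^ 2 + 2 * ∑ j ∈ Finset.range k, (∏ i ∈ Finset.range (j + 1), qEig q k i)⁻¹ *
    ladderSq q k (j + 1) (x / q ^ (j + 1))

/-- With `D` the first difference quotient at `x`, the telescoped sum leaves `-x·val·D`, the top
boundary term vanishing by degree. Since `val(qx) = val - xD`, the increment from `x` to `qx` is
exactly `(xD)^2`. -/
theorem ladderSum_le {q : ℝ} (hq0 : 0 < q) (hq1 : q < 1) (k : ℕ) {x : ℝ} (hx : x ≠ 0) :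
    ladderSum q k x ≤ ladderSum q k (q * x) := by
  have h := sum_ladderSq_sub hq0 hq1 k k le_rfl hx
  rw [qDiffQuot_val_vanish hq0 hq1 k (div_ne_zero hx (pow_pos hq0 k).ne')] at h
  simp only [mul_sub, Finset.sum_sub_distrib, mul_div_assoc', mul_zero, zero_sub] at h
  have d := qDiffQuot_succ_mul q (val q k) 0 hx
  simp only [zero_add] at d
  have d' : val q k (q * x) = val q k x - x * qDiffQuot q (val q k) 1 x := by
    rw [d]
    simp [qDiffQuot]
  rw [ladderSum, ladderSum, d']
  nlinarith [sq_nonneg (x * qDiffQuot q (val q k) 1 x)]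

theorem tendsto_ladderSq {q : ℝ} (hq0 : 0 < q) (hq1 : q < 1) (k j : ℕ) :
    Filter.Tendsto (fun m : ℕ => ladderSq q k (j + 1) (q ^ m / q ^ (j + 1))) Filter.atTop
      (nhds 0) := by
  obtain ⟨Q, hQ, hQe⟩ :=
    exists_poly_qDiffQuot hq0.ne' k (hyperPoly q k) (natDegree_hyperPoly_le q k) (j + 1)
  have hv : (fun x => (hyperPoly q k).eval x) = val q k := by
    ext x
    rw [val_eq_eval_hyperPoly hq0 hq1]
  rw [hv] at hQe
  have hcont : Continuous fun t : ℝ => t ^ (j + 1) * qPoch q (q * t) (j + 1) * Q.eval t ^ 2 := by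
    unfold qPoch
    fun_prop
  have hlim : Filter.Tendsto (fun m : ℕ => q ^ m / q ^ (j + 1)) Filter.atTop (nhds 0) := by
    simpa using (tendsto_pow_atTop_nhds_zero_of_lt_one hq0.le hq1).div_const (q ^ (j + 1))
  have := (hcont.tendsto 0).comp hlim
  simp only [ne_eq, Nat.add_eq_zero_iff, one_ne_zero, and_false, not_false_eq_true, zero_pow,
    zero_mul] at this
  refine this.congr fun m => ?_
  rw [Function.comp_apply, ladderSq,
    hQe _ (div_ne_zero (pow_pos hq0 m).ne' (pow_pos hq0 _).ne')]

theorem ladderSq_nonneg {q : ℝ} (hq0 : 0 < q) (hq1 : q < 1) (k j m : ℕ) :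
    0 ≤ ladderSq q k j (q ^ m / q ^ j) := by
  refine mul_nonneg (mul_nonneg (by positivity) ?_) (sq_nonneg _)
  have hq : q ≠ 0 := hq0.ne'
  rcases lt_or_ge m j with h | h
  -- For `m < j` the argument leaves the support, but the factor of index `j - 1 - m` vanishes.
  · refine (Finset.prod_eq_zero (Finset.mem_range.2 (show j - 1 - m < j by omega)) ?_).ge
    have : q ^ j = q ^ m * q * q ^ (j - 1 - m) := by
      rw [← pow_succ, ← pow_add]
      congr 1
      omega
    rw [this]
    have h1 := (pow_pos hq0 m).ne'
    have h2 := (pow_pos hq0 (j - 1 - m)).ne'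
    field_simp
    ring
  · refine Finset.prod_nonneg fun i _ => ?_
    obtain ⟨l, rfl⟩ := Nat.exists_eq_add_of_le h
    rw [pow_add, mul_div_cancel_left₀ _ (pow_pos hq0 j).ne', ← pow_succ', ← pow_add, sub_nonneg]
    exact pow_le_one₀ hq0.le hq1.le

theorem abs_val_pow_le_one {q : ℝ} (hq0 : 0 < q) (hq1 : q < 1) (k m : ℕ) :
    |val q k (q ^ m)| ≤ 1 := by
  have hmono : Monotone fun m : ℕ => ladderSum q k (q ^ m) :=
    monotone_nat_of_le_succ fun m => by
      rw [pow_succ']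
      exact ladderSum_le hq0 hq1 k (pow_pos hq0 m).ne'
  have hlim : Filter.Tendsto (fun m : ℕ => ladderSum q k (q ^ m)) Filter.atTop (nhds 1) := by
    have := ((tendsto_val_pow hq0 hq1 k).pow 2).add ((tendsto_finsetSum (Finset.range k) fun j _ =>
      (tendsto_ladderSq hq0 hq1 k j).const_mul
        (∏ i ∈ Finset.range (j + 1), qEig q k i)⁻¹).const_mul 2)
    simpa [ladderSum] using this
  have h1 : ladderSum q k (q ^ m) ≤ 1 := hmono.ge_of_tendsto hlim m
  have h2 : 0 ≤ ∑ j ∈ Finset.range k, (∏ i ∈ Finset.range (j + 1), qEig q k i)⁻¹ *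
      ladderSq q k (j + 1) (q ^ m / q ^ (j + 1)) :=
    Finset.sum_nonneg fun j hj => mul_nonneg (inv_nonneg.2 (Finset.prod_nonneg fun i hi =>
      (qEig_pos hq0 hq1 (by
        have := Finset.mem_range.1 hi
        have := Finset.mem_range.1 hj
        omega)).le)) (ladderSq_nonneg hq0 hq1 k (j + 1) m)
  rw [← sq_le_one_iff_abs_le_one]
  rw [ladderSum] at h1
  linarith

/-! ### Orthogonality and the Haar weights -/

theorem summable_pow_mul_val {q : ℝ} (hq0 : 0 < q) (hq1 : q < 1) (k l : ℕ) :
    Summable fun m : ℕ => q ^ m * (val q k (q ^ m) * val q l (q ^ m)) := by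
  refine (summable_geometric_of_lt_one hq0.le hq1).of_norm_bounded fun m => ?_
  rw [Real.norm_eq_abs, abs_mul, abs_mul, abs_of_pos (pow_pos hq0 m)]
  have h1 := abs_val_pow_le_one hq0 hq1 k m
  have h2 := abs_val_pow_le_one hq0 hq1 l m
  exact mul_le_of_le_one_right (pow_pos hq0 m).le (mul_le_one₀ h1 (abs_nonneg _) h2)

theorem summable_pow_mul_pow_mul_val {q : ℝ} (hq0 : 0 < q) (hq1 : q < 1) (k l : ℕ) :
    Summable fun m : ℕ => q ^ m * (q ^ m * (val q k (q ^ m) * val q l (q ^ m))) := by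
  refine (summable_pow_mul_val hq0 hq1 k l).abs.of_norm_bounded fun m => ?_
  rw [Real.norm_eq_abs, abs_mul, abs_of_pos (pow_pos hq0 m)]
  exact mul_le_of_le_one_left (abs_nonneg _) (pow_le_one₀ hq0.le hq1.le)

theorem qEig_zero_ne {q : ℝ} (hq0 : 0 < q) (hq1 : q < 1) {k l : ℕ} (h : k < l) :
    qEig q k 0 - qEig q l 0 ≠ 0 := by
  have := qEig_pos hq0 hq1 h
  rw [qEig] at *
  rw [qEig]
  linarith

theorem sum_range_pow_mul_val {q : ℝ} (hq0 : 0 < q) (hq1 : q < 1) (k l M : ℕ) :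
    ∑ m ∈ Finset.range M,
      (qEig q k 0 - qEig q l 0) * (q ^ m * (val q k (q ^ m) * val q l (q ^ m))) =
      (1 - q ^ M) * (val q k (q ^ (M - 1)) * val q l (q ^ M) -
        val q k (q ^ M) * val q l (q ^ (M - 1))) := by
  induction M with
  | zero => simp
  | succ M ih =>
    have h1 := val_qdiff_pow hq0 hq1 k M
    have h2 := val_qdiff_pow hq0 hq1 l M
    rw [Finset.sum_range_succ, ih, Nat.add_sub_cancel, qEig, qEig]
    linear_combination val q l (q ^ M) * h1 - val q k (q ^ M) * h2

/-- The partial sums are Casoratians of the dual recurrence; they tend to `1·1 - 1·1 = 0`, while the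
eigenvalues differ. -/
theorem tsum_pow_mul_val_of_lt {q : ℝ} (hq0 : 0 < q) (hq1 : q < 1) {k l : ℕ} (h : k < l) :
    ∑' m : ℕ, q ^ m * (val q k (q ^ m) * val q l (q ^ m)) = 0 := by
  have h1 := ((summable_pow_mul_val hq0 hq1 k l).hasSum.mul_left
    (qEig q k 0 - qEig q l 0)).tendsto_sum_nat
  simp only [sum_range_pow_mul_val hq0 hq1] at h1
  have hp : Filter.Tendsto (fun M : ℕ => M - 1) Filter.atTop Filter.atTop :=
    Filter.tendsto_sub_atTop_nat 1
  have tk := tendsto_val_pow hq0 hq1 k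
  have tl := tendsto_val_pow hq0 hq1 l
  have h2 := (((tendsto_pow_atTop_nhds_zero_of_lt_one hq0.le hq1).const_sub 1)).mul
    (((tk.comp hp).mul tl).sub (tk.mul (tl.comp hp)))
  have h3 := tendsto_nhds_unique h1 h2
  simp only [mul_one, sub_self, mul_zero, mul_eq_zero] at h3
  exact h3.resolve_left (qEig_zero_ne hq0 hq1 h)

theorem tsum_pow_mul_pow_mul_val {q : ℝ} (hq0 : 0 < q) (hq1 : q < 1) (k l : ℕ) :
    wt q k * ∑' m : ℕ, q ^ m * (q ^ m * (val q k (q ^ m) * val q l (q ^ m))) =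
      (edgeWt q (k + 1) + edgeWt q k) * ∑' m : ℕ, q ^ m * (val q k (q ^ m) * val q l (q ^ m)) -
      edgeWt q (k + 1) * ∑' m : ℕ, q ^ m * (val q (k + 1) (q ^ m) * val q l (q ^ m)) -
      edgeWt q k * ∑' m : ℕ, q ^ m * (val q (k - 1) (q ^ m) * val q l (q ^ m)) := by
  have s1 := (summable_pow_mul_pow_mul_val hq0 hq1 k l).hasSum.mul_left (wt q k)
  have s2 := (((summable_pow_mul_val hq0 hq1 k l).hasSum.mul_left (edgeWt q (k + 1) + edgeWt q k)).sub
    ((summable_pow_mul_val hq0 hq1 (k + 1) l).hasSum.mul_left (edgeWt q (k + 1)))).sub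
    ((summable_pow_mul_val hq0 hq1 (k - 1) l).hasSum.mul_left (edgeWt q k))
  have e : (fun m : ℕ => wt q k * (q ^ m * (q ^ m * (val q k (q ^ m) * val q l (q ^ m))))) =
      fun m : ℕ => (edgeWt q (k + 1) + edgeWt q k) * (q ^ m * (val q k (q ^ m) * val q l (q ^ m))) -
        edgeWt q (k + 1) * (q ^ m * (val q (k + 1) (q ^ m) * val q l (q ^ m))) -
        edgeWt q k * (q ^ m * (val q (k - 1) (q ^ m) * val q l (q ^ m))) := by
    funext m
    linear_combination (q ^ m * val q l (q ^ m)) * val_rec hq0 hq1 k (q ^ m)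
  rw [e] at s1
  exact s1.unique s2

/-- Expanding `∑ q^{2m} val_k val_{k+1}` by the recurrence at `k` and at `k + 1`, orthogonality
leaves one squared norm each time; comparison shows that weight times squared norm does not depend
on `k`. -/
theorem tsum_pow_mul_val_sq {q : ℝ} (hq0 : 0 < q) (hq1 : q < 1) (k : ℕ) :
    wt q k * ∑' m : ℕ, q ^ m * (val q k (q ^ m) * val q k (q ^ m)) = 1 := by
  induction k with
  | zero =>
    have : 1 - q ≠ 0 := by linarith
    simp only [val_zero, mul_one, tsum_geometric_of_lt_one hq0.le hq1, wt]
    field_simp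
    simp
  | succ k ih =>
    have h1 := tsum_pow_mul_pow_mul_val hq0 hq1 k (k + 1)
    have h2 := tsum_pow_mul_pow_mul_val hq0 hq1 (k + 1) k
    have comm : ∀ i j : ℕ, ∑' m : ℕ, q ^ m * (val q i (q ^ m) * val q j (q ^ m)) =
        ∑' m : ℕ, q ^ m * (val q j (q ^ m) * val q i (q ^ m)) := fun i j => by
      simp only [mul_comm (val q i _)]
    have comm' : ∀ i j : ℕ, ∑' m : ℕ, q ^ m * (q ^ m * (val q i (q ^ m) * val q j (q ^ m))) =
        ∑' m : ℕ, q ^ m * (q ^ m * (val q j (q ^ m) * val q i (q ^ m))) := fun i j => by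
      simp only [mul_comm (val q i _)]
    rw [tsum_pow_mul_val_of_lt hq0 hq1 (Nat.lt_succ_self k),
      tsum_pow_mul_val_of_lt hq0 hq1 (show k - 1 < k + 1 by omega)] at h1
    rw [comm (k + 1) k, comm (k + 1 + 1) k, tsum_pow_mul_val_of_lt hq0 hq1 (Nat.lt_succ_self k),
      tsum_pow_mul_val_of_lt hq0 hq1 (show k < k + 1 + 1 by omega), comm', Nat.add_sub_cancel] at h2
    refine mul_left_cancel₀ (edgeWt_succ_pos hq0 hq1 k).ne' ?_
    linear_combination wt q (k + 1) * h1 - wt q k * h2 + edgeWt q (k + 1) * ih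

theorem h_eq {q : ℝ} (hq0 : 0 < q) (hq1 : q < 1) (k : ℕ) : h q k = wt q k / (1 - q) := by
  have hq : 0 < 1 - q := sub_pos.2 hq1
  have hint : ∫ x, ((R q k).eval x) ^ 2 ∂(orthMeasure q) =
      (1 - q) * ∑' m : ℕ, q ^ m * (val q k (q ^ m) * val q k (q ^ m)) := by
    have hm : Measurable fun x => ((R q k).eval x) ^ 2 := by fun_prop
    rw [MeasureTheory.integral_eq_lintegral_of_nonneg_ae
      (Filter.Eventually.of_forall fun x => sq_nonneg _) hm.aestronglyMeasurable, orthMeasure,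
      MeasureTheory.lintegral_sum_measure, ← tsum_mul_left]
    have hnn : ∀ m : ℕ, 0 ≤ (1 - q) * (q ^ m * (val q k (q ^ m) * val q k (q ^ m))) := fun m =>
      mul_nonneg hq.le (mul_nonneg (pow_pos hq0 m).le (mul_self_nonneg _))
    have hs := (summable_pow_mul_val hq0 hq1 k k).mul_left (1 - q)
    rw [← ENNReal.toReal_ofReal (tsum_nonneg hnn), ENNReal.ofReal_tsum_of_nonneg hnn hs]
    congr 2
    ext m
    rw [MeasureTheory.lintegral_smul_measure, MeasureTheory.lintegral_dirac' _ hm.ennreal_ofReal,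
      smul_eq_mul, ← ENNReal.ofReal_mul (by positivity)]
    congr 1
    rw [val]
    ring
  have hk := tsum_pow_mul_val_sq hq0 hq1 k
  have hw := (wt_pos hq0 hq1 k).ne'
  rw [h, hint, eq_div_of_mul_eq hw ((mul_comm _ _).trans hk)]
  field_simp

/-! ### Superexponential decay in the degree -/

/-- Sequences decaying faster than every geometric sequence. -/
def RapidDecay (f : ℕ → ℝ) : Prop := ∀ B : ℝ, 0 < B → Summable fun k => |f k| * B ^ k

theorem RapidDecay.mono {f g : ℕ → ℝ} (hf : RapidDecay f) {K B : ℝ} (hB : 0 < B)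
    (hg : ∀ k, |g k| ≤ K * (B ^ k * |f k|)) : RapidDecay g := fun D hD => by
  refine ((hf (B * D) (mul_pos hB hD)).mul_left K).of_nonneg_of_le
    (fun k => mul_nonneg (abs_nonneg _) (pow_pos hD k).le) fun k => ?_
  refine (mul_le_mul_of_nonneg_right (hg k) (pow_pos hD k).le).trans_eq ?_
  rw [mul_pow]
  ring

theorem RapidDecay.add {f g : ℕ → ℝ} (hf : RapidDecay f) (hg : RapidDecay g) :
    RapidDecay fun k => f k + g k := fun B hB => by
  refine ((hf B hB).add (hg B hB)).of_nonneg_of_le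
    (fun k => mul_nonneg (abs_nonneg _) (pow_pos hB k).le) fun k => ?_
  rw [← add_mul]
  exact mul_le_mul_of_nonneg_right (abs_add_le _ _) (pow_pos hB k).le

theorem RapidDecay.summable {f : ℕ → ℝ} (hf : RapidDecay f) : Summable f := by
  have := hf 1 one_pos
  simp only [one_pow, mul_one] at this
  exact this.of_abs

theorem rapidDecay_pow_triangle {q : ℝ} (hq0 : 0 < q) (hq1 : q < 1) :
    RapidDecay fun k => q ^ (k * (k + 1) / 2) := fun B hB => by
  have ht : Filter.Tendsto (fun k : ℕ => q ^ (k + 1) * B) Filter.atTop (nhds 0) := by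
    have := ((Filter.tendsto_add_atTop_iff_nat 1).2
      (tendsto_pow_atTop_nhds_zero_of_lt_one hq0.le hq1)).mul_const B
    rwa [zero_mul] at this
  refine summable_of_ratio_test_tendsto_lt_one zero_lt_one
    (Filter.Eventually.of_forall fun k => by positivity) (ht.congr fun k => ?_)
  have e1 : (k + 1) * (k + 1 + 1) / 2 = k * (k + 1) / 2 + (k + 1) := by
    rw [show (k + 1) * (k + 1 + 1) = k * (k + 1) + (k + 1) * 2 by ring]
    omega
  beta_reduce
  rw [e1, Real.norm_of_nonneg (by positivity), Real.norm_of_nonneg (by positivity),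
    abs_of_pos (by positivity), abs_of_pos (by positivity), pow_add, pow_succ B]
  have := (pow_pos hB k).ne'
  have := (pow_pos hq0 (k * (k + 1) / 2)).ne'
  field_simp
  ring

/-- At `m = 0` the value is explicitly `± q^{k(k+1)/2}`. The dual recurrence then climbs in `m`,
costing only a factor `O(q^{-k})`, which rapid decay absorbs. -/
theorem rapidDecay_val {q : ℝ} (hq0 : 0 < q) (hq1 : q < 1) (m : ℕ) :
    RapidDecay fun k => val q k (q ^ m) := by
  induction m using Nat.strong_induction_on with
  | _ m ih =>
    rcases m with _ | m
    · refine (rapidDecay_pow_triangle hq0 hq1).mono (K := 1) one_pos fun k => ?_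
      simp [val_at_one hq0 hq1]
    · have hA := one_sub_pow_pos hq0 hq1 m
      have r1 : RapidDecay fun k => (2 - q ^ m * ((q ^ k)⁻¹ + q ^ (k + 1))) * val q k (q ^ m) := by
        refine (ih m (by omega)).mono (K := 4) (inv_pos.2 hq0) fun k => ?_
        rw [abs_mul, ← mul_assoc]
        refine mul_le_mul_of_nonneg_right ?_ (abs_nonneg _)
        have h1 : q ^ m ≤ 1 := pow_le_one₀ hq0.le hq1.le
        have h2 : q ^ (k + 1) ≤ 1 := pow_le_one₀ hq0.le hq1.le
        have h3 : 1 ≤ (q ^ k)⁻¹ := (one_le_inv₀ (pow_pos hq0 k)).2 (pow_le_one₀ hq0.le hq1.le)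
        have h4 := pow_pos hq0 m
        have h5 := pow_pos hq0 (k + 1)
        rw [inv_pow, abs_le]
        constructor <;> nlinarith
      have r2 : RapidDecay fun k => -(1 - q ^ m) * val q k (q ^ (m - 1)) := by
        refine (ih (m - 1) (by omega)).mono (K := 1) one_pos fun k => ?_
        rw [abs_mul, one_pow, one_mul, one_mul, abs_neg]
        refine mul_le_of_le_one_left (abs_nonneg _) ?_
        have h1 : q ^ m ≤ 1 := pow_le_one₀ hq0.le hq1.le
        have h4 := pow_pos hq0 m
        rw [abs_le]
        constructor <;> linarith
      refine (r1.add r2).mono (K := (1 - q ^ (m + 1))⁻¹) one_pos fun k => ?_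
      have h := val_qdiff_pow hq0 hq1 k m
      rw [one_pow, one_mul, ← abs_of_pos (inv_pos.2 hA), ← abs_mul]
      refine le_of_eq (congrArg _ ?_)
      rw [eq_inv_mul_iff_mul_eq₀ hA.ne']
      linear_combination h

theorem wt_le {q : ℝ} (hq0 : 0 < q) (k : ℕ) : wt q k ≤ q⁻¹ ^ k := by
  rw [wt, inv_pow]
  exact mul_le_of_le_one_right (inv_pos.2 (pow_pos hq0 k)).le
    (sub_le_self _ (pow_pos hq0 _).le)

theorem rapidDecay_wt_val_mul_val {q : ℝ} (hq0 : 0 < q) (hq1 : q < 1) (m n : ℕ) :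
    RapidDecay fun k => wt q k * (val q k (q ^ m) * val q k (q ^ n)) := by
  refine (rapidDecay_val hq0 hq1 m).mono (K := 1) (inv_pos.2 hq0) fun k => ?_
  rw [abs_mul, abs_mul, abs_of_pos (wt_pos hq0 hq1 k), one_mul]
  refine mul_le_mul (wt_le hq0 k) (mul_le_of_le_one_right (abs_nonneg _)
    (abs_val_pow_le_one hq0 hq1 k n)) (by positivity) (by positivity)

theorem summable_wt_mul_abs_val {q : ℝ} (hq0 : 0 < q) (hq1 : q < 1) (n : ℕ) :
    Summable fun k => wt q k * |val q k (q ^ n)| := by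
  have : RapidDecay fun k => wt q k * |val q k (q ^ n)| := by
    refine (rapidDecay_val hq0 hq1 n).mono (K := 1) (inv_pos.2 hq0) fun k => ?_
    rw [abs_mul, abs_of_pos (wt_pos hq0 hq1 k), one_mul, abs_abs]
    exact mul_le_mul_of_nonneg_right (wt_le hq0 k) (abs_nonneg _)
  exact this.summable

theorem tendsto_val_zero {q : ℝ} (hq0 : 0 < q) (hq1 : q < 1) (n : ℕ) :
    Filter.Tendsto (fun k => val q k (q ^ n)) Filter.atTop (nhds 0) :=
  (rapidDecay_val hq0 hq1 n).summable.tendsto_atTop_zero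

/-! ### Dual orthogonality -/

theorem sum_range_wt_val {q : ℝ} (hq0 : 0 < q) (hq1 : q < 1) (x y : ℝ) (K : ℕ) :
    ∑ k ∈ Finset.range K, (x - y) * (wt q k * (val q k x * val q k y)) =
      edgeWt q K * (val q (K - 1) x * val q K y - val q K x * val q (K - 1) y) := by
  induction K with
  | zero => simp [edgeWt_zero]
  | succ K ih =>
    have h1 := val_rec hq0 hq1 K x
    have h2 := val_rec hq0 hq1 K y
    rw [Finset.sum_range_succ, ih, Nat.add_sub_cancel]
    linear_combination val q K y * h1 - val q K x * h2

/-- Christoffel–Darboux: the boundary term tends to zero because the values decay in `k`. -/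
theorem tsum_wt_val_of_ne {q : ℝ} (hq0 : 0 < q) (hq1 : q < 1) {m n : ℕ} (h : m ≠ n) :
    ∑' k, wt q k * (val q k (q ^ m) * val q k (q ^ n)) = 0 := by
  have h1 := ((rapidDecay_wt_val_mul_val hq0 hq1 m n).summable.hasSum.mul_left
    (q ^ m - q ^ n)).tendsto_sum_nat
  simp only [sum_range_wt_val hq0 hq1] at h1
  have hp : Filter.Tendsto (fun M : ℕ => M - 1) Filter.atTop Filter.atTop :=
    Filter.tendsto_sub_atTop_nat 1
  have tm := tendsto_val_zero hq0 hq1 m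
  have tn := tendsto_val_zero hq0 hq1 n
  have hg : Filter.Tendsto (edgeWt q) Filter.atTop (nhds ((1 - 0) / (1 + 0))) := by
    have t := tendsto_pow_atTop_nhds_zero_of_lt_one hq0.le hq1
    exact Filter.Tendsto.div (tendsto_const_nhds.sub t) (tendsto_const_nhds.add t) (by norm_num)
  have h2 := hg.mul (((tm.comp hp).mul tn).sub (tm.mul (tn.comp hp)))
  have h3 := tendsto_nhds_unique h1 h2
  simp only [mul_zero, sub_self, mul_eq_zero] at h3
  refine h3.resolve_left (sub_ne_zero.2 fun he => h ?_)
  exact pow_right_injective₀ hq0 hq1.ne he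

theorem rapidDecay_eig_wt_val_mul_val {q : ℝ} (hq0 : 0 < q) (hq1 : q < 1) (m n : ℕ) :
    RapidDecay fun k => ((q ^ k)⁻¹ + q ^ (k + 1)) *
      (wt q k * (val q k (q ^ m) * val q k (q ^ n))) := by
  refine (rapidDecay_wt_val_mul_val hq0 hq1 m n).mono (K := 2) (inv_pos.2 hq0) fun k => ?_
  have h5 := pow_pos hq0 (k + 1)
  have h3 : 1 ≤ (q ^ k)⁻¹ := (one_le_inv₀ (pow_pos hq0 k)).2 (pow_le_one₀ hq0.le hq1.le)
  rw [abs_mul, abs_of_pos (show 0 < (q ^ k)⁻¹ + q ^ (k + 1) by positivity), inv_pow]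
  refine (mul_le_mul_of_nonneg_right ?_ (abs_nonneg _)).trans_eq (mul_assoc _ _ _)
  have h2 : q ^ (k + 1) ≤ 1 := pow_le_one₀ hq0.le hq1.le
  linarith

theorem tsum_eig_wt_val {q : ℝ} (hq0 : 0 < q) (hq1 : q < 1) (m n : ℕ) :
    q ^ m * ∑' k, ((q ^ k)⁻¹ + q ^ (k + 1)) * (wt q k * (val q k (q ^ m) * val q k (q ^ n))) =
      2 * ∑' k, wt q k * (val q k (q ^ m) * val q k (q ^ n)) -
      (1 - q ^ (m + 1)) * ∑' k, wt q k * (val q k (q ^ (m + 1)) * val q k (q ^ n)) -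
      (1 - q ^ m) * ∑' k, wt q k * (val q k (q ^ (m - 1)) * val q k (q ^ n)) := by
  have s1 := (rapidDecay_eig_wt_val_mul_val hq0 hq1 m n).summable.hasSum.mul_left (q ^ m)
  have s2 := (((rapidDecay_wt_val_mul_val hq0 hq1 m n).summable.hasSum.mul_left 2).sub
    ((rapidDecay_wt_val_mul_val hq0 hq1 (m + 1) n).summable.hasSum.mul_left
      (1 - q ^ (m + 1)))).sub
    ((rapidDecay_wt_val_mul_val hq0 hq1 (m - 1) n).summable.hasSum.mul_left (1 - q ^ m))
  have e : (fun k => q ^ m * (((q ^ k)⁻¹ + q ^ (k + 1)) *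
      (wt q k * (val q k (q ^ m) * val q k (q ^ n))))) =
      fun k => 2 * (wt q k * (val q k (q ^ m) * val q k (q ^ n))) -
        (1 - q ^ (m + 1)) * (wt q k * (val q k (q ^ (m + 1)) * val q k (q ^ n))) -
        (1 - q ^ m) * (wt q k * (val q k (q ^ (m - 1)) * val q k (q ^ n))) := by
    funext k
    linear_combination (wt q k * val q k (q ^ n)) * val_qdiff_pow hq0 hq1 k m
  rw [e] at s1
  exact s1.unique s2

theorem hasSum_pow_sq_sub {q : ℝ} (hq0 : 0 < q) (hq1 : q < 1) :
    HasSum (fun k : ℕ => q ^ (k ^ 2) - q ^ ((k + 1) ^ 2)) 1 := by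
  have hs : Summable fun k : ℕ => q ^ (k ^ 2) :=
    (summable_geometric_of_lt_one hq0.le hq1).of_nonneg_of_le (fun k => by positivity) fun k =>
      pow_le_pow_of_le_one hq0.le hq1.le (Nat.le_self_pow two_ne_zero k)
  have hs' := (summable_nat_add_iff 1).2 hs
  have h := (hs.sub hs').hasSum
  rw [hs.tsum_sub hs', hs.tsum_eq_zero_add] at h
  simpa using h

/-- The dual orthogonality relations, diagonal case. -/
theorem hasSum_wt_val_sq {q : ℝ} (hq0 : 0 < q) (hq1 : q < 1) (n : ℕ) :
    HasSum (fun k => wt q k * (val q k (q ^ n) * val q k (q ^ n))) (q ^ n)⁻¹ := by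
  have hsum := fun m => (rapidDecay_wt_val_mul_val hq0 hq1 m m).summable.hasSum
  induction n with
  | zero =>
    -- At `x = 1` the summand is `q^{k^2} - q^{(k+1)^2}`, which telescopes.
    convert hasSum_pow_sq_sub hq0 hq1 using 2 with k
    · have h := pow_add q (k * (k + 1) / 2) (k * (k + 1) / 2)
      have h1 : k * (k + 1) / 2 + k * (k + 1) / 2 = k ^ 2 + k := by
        have := Nat.even_mul_succ_self k
        have := Nat.div_two_mul_two_of_even this
        nlinarith
      have h2 : (-1 : ℝ) ^ k * (-1) ^ k = 1 := by rw [← mul_pow]; norm_num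
      have hz := (pow_pos hq0 k).ne'
      have h3 : (k + 1) ^ 2 = k ^ 2 + (2 * k + 1) := by ring
      rw [h1, pow_add] at h
      rw [pow_zero, val_at_one hq0 hq1, mul_mul_mul_comm, h2, ← h, one_mul, wt, h3, pow_add q (k ^ 2)]
      field_simp
    · simp
  | succ n ih =>
    -- The eigenvalue-weighted mixed sum of `n` and `n + 1` is computed from either side; comparison
    -- gives the ratio `1/q` of consecutive norms.
    have h1 := tsum_eig_wt_val hq0 hq1 n (n + 1)
    have h2 := tsum_eig_wt_val hq0 hq1 (n + 1) n
    rw [tsum_wt_val_of_ne hq0 hq1 (show n ≠ n + 1 by omega),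
      tsum_wt_val_of_ne hq0 hq1 (show n - 1 ≠ n + 1 by omega)] at h1
    rw [tsum_wt_val_of_ne hq0 hq1 (show n + 1 ≠ n by omega),
      tsum_wt_val_of_ne hq0 hq1 (show n + 1 + 1 ≠ n by omega), Nat.add_sub_cancel, ih.tsum_eq] at h2
    have comm : ∑' k, ((q ^ k)⁻¹ + q ^ (k + 1)) *
        (wt q k * (val q k (q ^ (n + 1)) * val q k (q ^ n))) = ∑' k, ((q ^ k)⁻¹ + q ^ (k + 1)) *
        (wt q k * (val q k (q ^ n) * val q k (q ^ (n + 1)))) := by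
      simp only [mul_comm (val q _ (q ^ (n + 1)))]
    rw [comm] at h2
    have key : ∑' k, wt q k * (val q k (q ^ (n + 1)) * val q k (q ^ (n + 1))) =
        (q ^ (n + 1))⁻¹ := by
      refine mul_left_cancel₀ (one_sub_pow_pos hq0 hq1 n).ne' ?_
      have hz := (pow_pos hq0 n).ne'
      refine mul_left_cancel₀ hq0.ne' ?_
      have hinv : q * (q ^ (n + 1))⁻¹ = (q ^ n)⁻¹ := by
        rw [pow_succ]
        field_simp
      have hp := pow_succ q n
      linear_combination q * h1 - h2 - (1 - q ^ (n + 1)) * hinv - (∑' k, ((q ^ k)⁻¹ +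
        q ^ (k + 1)) * (wt q k * (val q k (q ^ n) * val q k (q ^ (n + 1))))) * hp
    rw [← key]
    exact hsum (n + 1)

/-! ### Decay beyond the turning point -/

theorem edgeWt_le {q : ℝ} (hq0 : 0 < q) (hq1 : q < 1) (k : ℕ) : edgeWt q k ≤ 1 - q ^ k := by
  have h1 : q ^ k ≤ 1 := pow_le_one₀ hq0.le hq1.le
  have h2 := pow_pos hq0 k
  exact div_le_self (by linarith) (by linarith)

theorem edgeWt_add_edgeWt_le {q : ℝ} (hq0 : 0 < q) (hq1 : q < 1) (k : ℕ) :
    edgeWt q (k + 1) + edgeWt q k ≤ 2 * (1 - q ^ (2 * k + 1)) := by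
  have hz := pow_pos hq0 k
  have hz' := pow_pos hq0 (k + 1)
  have e : edgeWt q (k + 1) + edgeWt q k =
      2 * (1 - q ^ (2 * k + 1)) / ((1 + q ^ (k + 1)) * (1 + q ^ k)) := by
    rw [edgeWt, edgeWt, show 2 * k + 1 = k + (k + 1) by ring, pow_add]
    field_simp
    ring
  rw [e]
  refine div_le_self (mul_nonneg two_pos.le (one_sub_pow_pos hq0 hq1 _).le) ?_
  nlinarith

theorem pow_mul_wt_ge {q : ℝ} (hq0 : 0 < q) (hq1 : q < 1) {n k : ℕ} (h : 4 * q ^ k ≤ q ^ n) :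
    4 * (1 - q ^ (2 * k + 1)) ≤ q ^ n * wt q k := by
  rw [wt, ← mul_assoc]
  refine mul_le_mul_of_nonneg_right ?_ (one_sub_pow_pos hq0 hq1 _).le
  rwa [← div_eq_mul_inv, le_div_iff₀ (pow_pos hq0 k)]

theorem abs_val_rec {q : ℝ} (hq0 : 0 < q) (hq1 : q < 1) (k : ℕ) (x : ℝ) :
    (x * wt q k - edgeWt q (k + 1) - edgeWt q k) * |val q k x| ≤
      edgeWt q (k + 1) * |val q (k + 1) x| + edgeWt q k * |val q (k - 1) x| := by
  have hg := (edgeWt_succ_pos hq0 hq1 k).le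
  have hg' : 0 ≤ edgeWt q k := by
    rcases k with _ | k
    · rw [edgeWt_zero]
    · exact (edgeWt_succ_pos hq0 hq1 k).le
  calc (x * wt q k - edgeWt q (k + 1) - edgeWt q k) * |val q k x|
      ≤ |(edgeWt q (k + 1) + edgeWt q k - x * wt q k) * val q k x| := by
        rw [abs_mul]
        refine mul_le_mul_of_nonneg_right ?_ (abs_nonneg _)
        rw [abs_sub_comm]
        exact (le_abs_self _).trans_eq' (by ring)
    _ ≤ _ := by
        rw [← val_rec hq0 hq1 k x]
        refine (abs_add_le _ _).trans_eq ?_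
        rw [abs_mul, abs_mul, abs_of_nonneg hg, abs_of_nonneg hg']

/-- Here `x·wt` is at least twice the sum of the two conductances, so one increase of `|val|` would
propagate to all later `k`, contradicting convergence to zero. -/
theorem abs_val_succ_le {q : ℝ} (hq0 : 0 < q) (hq1 : q < 1) {n k : ℕ}
    (h : 4 * q ^ k ≤ q ^ n) : |val q (k + 1) (q ^ n)| ≤ |val q k (q ^ n)| := by
  by_contra! hlt
  have hstep : ∀ j, |val q (k + j) (q ^ n)| ≤ |val q (k + j + 1) (q ^ n)| := by
    intro j
    induction j with
    | zero => exact hlt.le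
    | succ j ih =>
      have h4 : 4 * q ^ (k + j + 1) ≤ q ^ n :=
        (mul_le_mul_of_nonneg_left (pow_le_pow_of_le_one hq0.le hq1.le (by omega))
          (by norm_num)).trans h
      have h1 := abs_val_rec hq0 hq1 (k + j + 1) (q ^ n)
      have h2 := pow_mul_wt_ge hq0 hq1 h4
      have h3 := edgeWt_add_edgeWt_le hq0 hq1 (k + j + 1)
      have g1 := edgeWt_succ_pos hq0 hq1 (k + j)
      have g2 := edgeWt_succ_pos hq0 hq1 (k + j + 1)
      rw [Nat.add_sub_cancel] at h1
      have h5 : (edgeWt q (k + j + 1 + 1) + edgeWt q (k + j + 1)) * |val q (k + j + 1) (q ^ n)| ≤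
          (q ^ n * wt q (k + j + 1) - edgeWt q (k + j + 1 + 1) - edgeWt q (k + j + 1)) *
            |val q (k + j + 1) (q ^ n)| :=
        mul_le_mul_of_nonneg_right (by linarith) (abs_nonneg _)
      have h6 := mul_le_mul_of_nonneg_left ih g1.le
      refine le_of_mul_le_mul_left ?_ g2
      rw [← add_assoc]
      linarith
  have hge : ∀ j, |val q (k + 1) (q ^ n)| ≤ |val q (j + (k + 1)) (q ^ n)| := by
    intro j
    induction j with
    | zero => simp
    | succ j ih =>
      refine ih.trans ?_
      have := hstep (j + 1)
      rwa [show k + (j + 1) = j + (k + 1) by ring,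
        show j + (k + 1) + 1 = j + 1 + (k + 1) by ring] at this
  have hlim := ((Filter.tendsto_add_atTop_iff_nat (k + 1)).2 (tendsto_val_zero hq0 hq1 n)).abs
  rw [abs_zero] at hlim
  have := ge_of_tendsto' hlim hge
  linarith [abs_nonneg (val q k (q ^ n))]

theorem one_sub_mul_abs_val_succ_le {q : ℝ} (hq0 : 0 < q) (hq1 : q < 1) {n k : ℕ}
    (h : 4 * q ^ (k + 1) ≤ q ^ n) :
    q ^ n * ((1 - q ^ (2 * (k + 1) + 1)) * |val q (k + 1) (q ^ n)|) ≤
      4 * q ^ (k + 1) * ((1 - q ^ (2 * k + 1)) * |val q k (q ^ n)|) := by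
  have h1 := abs_val_rec hq0 hq1 (k + 1) (q ^ n)
  have h2 := edgeWt_add_edgeWt_le hq0 hq1 (k + 1)
  have h3 := pow_mul_wt_ge hq0 hq1 h
  have g2 := edgeWt_succ_pos hq0 hq1 (k + 1)
  have g3 := edgeWt_le hq0 hq1 (k + 1 + 1)
  have g4 := edgeWt_le hq0 hq1 (k + 1)
  rw [Nat.add_sub_cancel] at h1
  have hm := mul_le_mul_of_nonneg_left (abs_val_succ_le hq0 hq1 h) g2.le
  have p1 : q ^ (2 * (k + 1) + 1) ≤ q ^ (k + 1 + 1) :=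
    pow_le_pow_of_le_one hq0.le hq1.le (by omega)
  have p2 : q ^ (2 * k + 1) ≤ q ^ (k + 1) := pow_le_pow_of_le_one hq0.le hq1.le (by omega)
  have hv := abs_nonneg (val q k (q ^ n))
  have hv' := abs_nonneg (val q (k + 1) (q ^ n))
  -- Of `x·wt ≥ 4(1 - q^{2k+3})`, the three subtracted conductances use at most three quarters.
  have h5 : q ^ n * wt q (k + 1) / 4 * |val q (k + 1) (q ^ n)| ≤
      (q ^ n * wt q (k + 1) - edgeWt q (k + 1 + 1) - edgeWt q (k + 1) - edgeWt q (k + 1 + 1)) *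
        |val q (k + 1) (q ^ n)| :=
    mul_le_mul_of_nonneg_right (by linarith) hv'
  have h6 : edgeWt q (k + 1) * |val q k (q ^ n)| ≤ (1 - q ^ (2 * k + 1)) * |val q k (q ^ n)| :=
    mul_le_mul_of_nonneg_right (by linarith) hv
  have h7 : q ^ n * wt q (k + 1) / 4 * |val q (k + 1) (q ^ n)| ≤
      (1 - q ^ (2 * k + 1)) * |val q k (q ^ n)| := by linarith
  have hz := pow_pos hq0 (k + 1)
  have h8 := mul_le_mul_of_nonneg_left h7 (show 0 ≤ 4 * q ^ (k + 1) by positivity)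
  refine h8.trans_eq' ?_
  rw [wt]
  field_simp

/-! ### The explicit constant and the upper bound -/

theorem exists_nat_N {q : ℝ} (hq0 : 0 < q) (hq1 : q < 1) :
    ∃ M : ℕ, N q = M ∧ 4 * q ^ (M + 1) ≤ 1 := by
  have hl : 0 < Real.log (1 / q) := Real.log_pos ((one_lt_div hq0).2 hq1)
  have hn : 0 ≤ N q := by
    have h : (-1 : ℤ) < N q := by
      refine Int.lt_ceil.2 ?_
      have : 0 < Real.log 4 / Real.log (1 / q) := div_pos (Real.log_pos (by norm_num)) hl
      push_cast
      linarith
    omega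
  obtain ⟨M, hM⟩ := Int.eq_ofNat_of_zero_le hn
  refine ⟨M, hM, ?_⟩
  have h1 : Real.log 4 / Real.log (1 / q) - 1 ≤ (N q : ℝ) := Int.le_ceil _
  rw [hM, Int.cast_natCast, sub_le_iff_le_add, div_le_iff₀ hl] at h1
  have h2 : Real.log 4 ≤ Real.log ((1 / q) ^ (M + 1)) := by
    rw [Real.log_pow]
    exact_mod_cast h1
  rw [Real.log_le_log_iff (by norm_num) (by positivity), one_div, inv_pow] at h2
  rwa [← le_div_iff₀ (pow_pos hq0 _), one_div]

theorem seriesTerm_zero (q : ℝ) : seriesTerm q 0 = 1 := by simp [seriesTerm]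

theorem seriesTerm_succ {q : ℝ} (hq0 : 0 < q) {M : ℕ} (hM : N q = M) (k : ℕ) :
    seriesTerm q (k + 1) = seriesTerm q k * (4 * q ^ (M + k)) := by
  rw [seriesTerm, seriesTerm, hM, pow_succ, ← Real.rpow_natCast q (M + k), mul_mul_mul_comm,
    ← Real.rpow_add hq0]
  congr 2
  push_cast
  ring

theorem seriesTerm_pos {q : ℝ} (hq0 : 0 < q) (k : ℕ) : 0 < seriesTerm q k :=
  mul_pos (by positivity) (Real.rpow_pos_of_pos hq0 _)

theorem summable_seriesTerm {q : ℝ} (hq0 : 0 < q) (hq1 : q < 1) : Summable (seriesTerm q) := by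
  obtain ⟨M, hM, -⟩ := exists_nat_N hq0 hq1
  have ht : Filter.Tendsto (fun k : ℕ => 4 * q ^ (M + k)) Filter.atTop (nhds 0) := by
    have := ((tendsto_pow_atTop_nhds_zero_of_lt_one hq0.le hq1).const_mul (q ^ M)).const_mul 4
    simpa [pow_add] using this
  refine summable_of_ratio_test_tendsto_lt_one zero_lt_one
    (Filter.Eventually.of_forall fun k => (seriesTerm_pos hq0 k).ne') (ht.congr fun k => ?_)
  have h := seriesTerm_pos hq0 k
  rw [Real.norm_of_nonneg (seriesTerm_pos hq0 _).le, Real.norm_of_nonneg h.le,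
    seriesTerm_succ hq0 hM, mul_div_cancel_left₀ _ h.ne']

/-- The decay factor `4 q^{M+i+1}` is `q` times the ratio of consecutive series terms; the surplus
`q^i` cancels the growth of `wt`. -/
theorem wt_mul_abs_val_tail_le {q : ℝ} (hq0 : 0 < q) (hq1 : q < 1) {M : ℕ} (hM : N q = M)
    (hM4 : 4 * q ^ (M + 1) ≤ 1) (n i : ℕ) :
    wt q (n + M + i) * |val q (n + M + i) (q ^ n)| ≤ (q ^ (n + M))⁻¹ * seriesTerm q i := by
  have key : (1 - q ^ (2 * (n + M + i) + 1)) * |val q (n + M + i) (q ^ n)| ≤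
      q ^ i * seriesTerm q i := by
    induction i with
    | zero =>
      rw [seriesTerm_zero, pow_zero, one_mul]
      exact mul_le_one₀ (sub_le_self _ (pow_pos hq0 _).le) (abs_nonneg _)
        (abs_val_pow_le_one hq0 hq1 _ n)
    | succ i ih =>
      have h4 : 4 * q ^ (n + M + i + 1) ≤ q ^ n := by
        have e : q ^ (n + M + i + 1) = q ^ n * (q ^ (M + 1) * q ^ i) := by ring
        have h1 : q ^ i ≤ 1 := pow_le_one₀ hq0.le hq1.le
        have h2 := pow_pos hq0 n
        have h3 := mul_le_mul_of_nonneg_left h1 (pow_pos hq0 (M + 1)).le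
        rw [e]
        nlinarith
      have h := one_sub_mul_abs_val_succ_le hq0 hq1 h4
      refine le_of_mul_le_mul_left (h.trans ?_) (pow_pos hq0 n)
      rw [seriesTerm_succ hq0 hM]
      refine (mul_le_mul_of_nonneg_left ih (by positivity)).trans_eq ?_
      ring
  rw [wt, mul_assoc]
  refine (mul_le_mul_of_nonneg_left key (inv_pos.2 (pow_pos hq0 _)).le).trans_eq ?_
  rw [pow_add q (n + M) i]
  have := (pow_pos hq0 i).ne'
  field_simp

theorem sum_range_wt_lt {q : ℝ} (hq0 : 0 < q) (hq1 : q < 1) (K : ℕ) :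
    ∑ k ∈ Finset.range (K + 1), wt q k < (q ^ K)⁻¹ / (1 - q) := by
  have hq : 0 < 1 - q := sub_pos.2 hq1
  induction K with
  | zero =>
    simp only [zero_add, Finset.sum_range_one, wt, pow_zero, inv_one, one_mul, mul_zero, pow_one]
    rw [lt_div_iff₀ hq]
    nlinarith
  | succ K ih =>
    rw [Finset.sum_range_succ]
    have h1 := wt_le hq0 (K + 1)
    refine (add_lt_add_of_lt_of_le ih h1).trans_eq ?_
    have := (pow_pos hq0 K).ne'
    have := hq.ne'
    rw [inv_pow, pow_succ]
    field_simp
    ring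

theorem tsum_wt_mul_abs_val_lt {q : ℝ} (hq0 : 0 < q) (hq1 : q < 1) (n : ℕ) :
    ∑' k, wt q k * |val q k (q ^ n)| < explicitConst q * (q ^ n)⁻¹ := by
  obtain ⟨M, hM, hM4⟩ := exists_nat_N hq0 hq1
  have hs := summable_wt_mul_abs_val hq0 hq1 n
  have hS := (summable_nat_add_iff 1).2 (summable_seriesTerm hq0 hq1)
  rw [← hs.sum_add_tsum_nat_add (n + M + 1)]
  have hhead : ∑ k ∈ Finset.range (n + M + 1), wt q k * |val q k (q ^ n)| <
      (q ^ (n + M))⁻¹ / (1 - q) :=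
    (Finset.sum_le_sum fun k _ => mul_le_of_le_one_right (wt_pos hq0 hq1 k).le
      (abs_val_pow_le_one hq0 hq1 k n)).trans_lt (sum_range_wt_lt hq0 hq1 _)
  have htail : ∑' i, wt q (i + (n + M + 1)) * |val q (i + (n + M + 1)) (q ^ n)| ≤
      (q ^ (n + M))⁻¹ * ∑' i, seriesTerm q (i + 1) := by
    rw [← tsum_mul_left]
    refine ((summable_nat_add_iff (n + M + 1)).2 hs).tsum_le_tsum (fun i => ?_) (hS.mul_left _)
    rw [show i + (n + M + 1) = n + M + (i + 1) by ring]
    exact wt_mul_abs_val_tail_le hq0 hq1 hM hM4 n (i + 1)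
  have hpos : 0 ≤ ∑' i, seriesTerm q (i + 1) := tsum_nonneg fun i => (seriesTerm_pos hq0 _).le
  have hden := one_sub_pow_pos hq0 hq1 (2 * M)
  -- The factor `1 / (1 - q^{2M+1})` exceeds 1 and only weakens the bound.
  have hle : ∑' i, seriesTerm q (i + 1) ≤
      1 / (1 - q ^ (2 * M + 1)) * ∑' i, seriesTerm q (i + 1) := by
    refine le_mul_of_one_le_left hpos ?_
    rw [le_div_iff₀ hden]
    linarith [pow_pos hq0 (2 * M + 1)]
  have hz := inv_pos.2 (pow_pos hq0 (n + M))
  have e : explicitConst q * (q ^ n)⁻¹ = (q ^ (n + M))⁻¹ / (1 - q) +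
      (q ^ (n + M))⁻¹ * (1 / (1 - q ^ (2 * M + 1)) * ∑' i, seriesTerm q (i + 1)) := by
    rw [explicitConst, hM, zpow_natCast, pow_add, mul_inv,
      show (2 * (M : ℤ) + 1) = ((2 * M + 1 : ℕ) : ℤ) by push_cast; ring, zpow_natCast]
    ring
  rw [e]
  exact add_lt_add_of_lt_of_le hhead (htail.trans (mul_le_mul_of_nonneg_left hle hz.le))

theorem explicitConst_pos {q : ℝ} (hq0 : 0 < q) (hq1 : q < 1) : 0 < explicitConst q := by
  have h := tsum_wt_mul_abs_val_lt hq0 hq1 0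
  have h0 : 0 ≤ ∑' k, wt q k * |val q k (q ^ 0)| :=
    tsum_nonneg fun k => mul_nonneg (wt_pos hq0 hq1 k).le (abs_nonneg _)
  rw [pow_zero, inv_one, mul_one] at h
  rw [pow_zero] at h0
  exact h0.trans_lt h

/-! ### The strict lower bound -/

theorem not_consecutive_zeros {q : ℝ} (hq0 : 0 < q) (hq1 : q < 1) (k : ℕ) (x : ℝ) :
    val q k x ≠ 0 ∨ val q (k + 1) x ≠ 0 := by
  induction k with
  | zero => exact Or.inl (by rw [val_zero]; exact one_ne_zero)
  | succ k ih =>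
    by_contra! hc
    have h := val_rec hq0 hq1 (k + 1) x
    rw [hc.1, hc.2, Nat.add_sub_cancel, mul_zero, mul_zero, zero_add, mul_eq_zero] at h
    have h0 := h.resolve_left (edgeWt_succ_pos hq0 hq1 k).ne'
    exact ih.elim (fun h => h h0) fun h => h hc.1

theorem tsum_wt_mul_sq_lt {q : ℝ} (hq0 : 0 < q) (hq1 : q < 1) (n : ℕ) :
    (q ^ n)⁻¹ < ∑' k, wt q k * |val q k (q ^ n)| := by
  have hsq := hasSum_wt_val_sq hq0 hq1 n
  have hs := summable_wt_mul_abs_val hq0 hq1 n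
  rw [← hsq.tsum_eq]
  have hle : ∀ k, val q k (q ^ n) * val q k (q ^ n) ≤ |val q k (q ^ n)| := fun k => by
    rw [← abs_mul_abs_self]
    exact mul_le_of_le_one_left (abs_nonneg _) (abs_val_pow_le_one hq0 hq1 k n)
  -- Far out all values are below 1 in modulus, and two neighbours cannot both vanish.
  have hex : ∃ k, val q k (q ^ n) ≠ 0 ∧ |val q k (q ^ n)| < 1 := by
    have hlim := (tendsto_val_zero hq0 hq1 n).abs
    rw [abs_zero] at hlim
    obtain ⟨K, hK⟩ := Filter.eventually_atTop.1 (hlim.eventually_lt_const one_pos)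
    rcases not_consecutive_zeros hq0 hq1 K (q ^ n) with h | h
    · exact ⟨K, h, hK K le_rfl⟩
    · exact ⟨K + 1, h, hK (K + 1) (by omega)⟩
  obtain ⟨k, hk0, hk1⟩ := hex
  refine Summable.tsum_lt_tsum (i := k)
    (fun j => mul_le_mul_of_nonneg_left (hle j) (wt_pos hq0 hq1 j).le) ?_ hsq.summable hs
  refine mul_lt_mul_of_pos_left ?_ (wt_pos hq0 hq1 k)
  rw [← abs_mul_abs_self]
  exact mul_lt_of_lt_one_left (abs_pos.2 hk0) hk1

/-! ### Translation to the norms of the characters -/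

theorem norm_character (q : ℝ) (n k : ℕ) :
    ‖character q ((1 - q ^ n : ℝ) : ℂ) k‖ = |val q k (q ^ n)| := by
  have : character q ((1 - q ^ n : ℝ) : ℂ) k = ((val q k (q ^ n) : ℝ) : ℂ) :=
    aeval_algebraMap_apply_eq_algebraMap_eval _ _
  rw [this, Complex.norm_real, Real.norm_eq_abs]

theorem hasSum_character_one {q : ℝ} (hq0 : 0 < q) (hq1 : q < 1) (n : ℕ) :
    HasSum (fun k => ‖character q ((1 - q ^ n : ℝ) : ℂ) k‖ ^ (1 : ℝ) * h q k)
      ((∑' k, wt q k * |val q k (q ^ n)|) / (1 - q)) := by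
  have e : (fun k => ‖character q ((1 - q ^ n : ℝ) : ℂ) k‖ ^ (1 : ℝ) * h q k) =
      fun k => wt q k * |val q k (q ^ n)| / (1 - q) := by
    funext k
    rw [norm_character, h_eq hq0 hq1, Real.rpow_one]
    ring
  rw [e]
  exact (summable_wt_mul_abs_val hq0 hq1 n).hasSum.div_const _

theorem hasSum_character_two {q : ℝ} (hq0 : 0 < q) (hq1 : q < 1) (n : ℕ) :
    HasSum (fun k => ‖character q ((1 - q ^ n : ℝ) : ℂ) k‖ ^ (2 : ℝ) * h q k)
      ((q ^ n)⁻¹ / (1 - q)) := by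
  have e : (fun k => ‖character q ((1 - q ^ n : ℝ) : ℂ) k‖ ^ (2 : ℝ) * h q k) =
      fun k => wt q k * (val q k (q ^ n) * val q k (q ^ n)) / (1 - q) := by
    funext k
    rw [norm_character, h_eq hq0 hq1, Real.rpow_two, sq_abs]
    ring
  rw [e]
  exact (hasSum_wt_val_sq hq0 hq1 n).div_const _

theorem normP_one {q : ℝ} (hq0 : 0 < q) (hq1 : q < 1) (n : ℕ) :
    normP q 1 (character q ((1 - q ^ n : ℝ) : ℂ)) =
      (∑' k, wt q k * |val q k (q ^ n)|) / (1 - q) := by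
  rw [normP, (hasSum_character_one hq0 hq1 n).tsum_eq, div_one, Real.rpow_one]

theorem normP_two_sq {q : ℝ} (hq0 : 0 < q) (hq1 : q < 1) (n : ℕ) :
    normP q 2 (character q ((1 - q ^ n : ℝ) : ℂ)) ^ 2 = (q ^ n)⁻¹ / (1 - q) := by
  have hq : 0 < 1 - q := sub_pos.2 hq1
  rw [normP, (hasSum_character_two hq0 hq1 n).tsum_eq, ← Real.sqrt_eq_rpow,
    Real.sq_sqrt (by positivity)]

end LittleQLegendre

theorem theorem2p1 (q : ℝ) (hq0 : 0 < q) (hq1 : q < 1) :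
    (∀ n : ℕ,
      LittleQLegendre.MemEllP q 1 (LittleQLegendre.character q ((1 - q ^ n : ℝ) : ℂ)) ∧
      LittleQLegendre.MemEllP q 2 (LittleQLegendre.character q ((1 - q ^ n : ℝ) : ℂ))) ∧
    (∃ C : ℝ, 0 < C ∧ ∀ n : ℕ,
      0 < LittleQLegendre.normP q 2 (LittleQLegendre.character q ((1 - q ^ n : ℝ) : ℂ)) ^ 2 ∧
      LittleQLegendre.normP q 2 (LittleQLegendre.character q ((1 - q ^ n : ℝ) : ℂ)) ^ 2 <
        LittleQLegendre.normP q 1 (LittleQLegendre.character q ((1 - q ^ n : ℝ) : ℂ)) ∧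
      LittleQLegendre.normP q 1 (LittleQLegendre.character q ((1 - q ^ n : ℝ) : ℂ)) <
        C * LittleQLegendre.normP q 2
          (LittleQLegendre.character q ((1 - q ^ n : ℝ) : ℂ)) ^ 2) ∧
    (Summable (fun k : ℕ => LittleQLegendre.seriesTerm q (k + 1)) ∧
      0 < LittleQLegendre.explicitConst q ∧
      ∀ n : ℕ,
        LittleQLegendre.normP q 1 (LittleQLegendre.character q ((1 - q ^ n : ℝ) : ℂ)) <
          LittleQLegendre.explicitConst q * LittleQLegendre.normP q 2
            (LittleQLegendre.character q ((1 - q ^ n : ℝ) : ℂ)) ^ 2) := by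
  have hq : 0 < 1 - q := sub_pos.2 hq1
  have hup : ∀ n : ℕ,
      LittleQLegendre.normP q 1 (LittleQLegendre.character q ((1 - q ^ n : ℝ) : ℂ)) <
        LittleQLegendre.explicitConst q * LittleQLegendre.normP q 2
          (LittleQLegendre.character q ((1 - q ^ n : ℝ) : ℂ)) ^ 2 := fun n => by
    rw [LittleQLegendre.normP_one hq0 hq1, LittleQLegendre.normP_two_sq hq0 hq1, mul_div_assoc']
    exact div_lt_div_of_pos_right (LittleQLegendre.tsum_wt_mul_abs_val_lt hq0 hq1 n) hq
  refine ⟨fun n => ⟨(LittleQLegendre.hasSum_character_one hq0 hq1 n).summable,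
    (LittleQLegendre.hasSum_character_two hq0 hq1 n).summable⟩,
    ⟨LittleQLegendre.explicitConst q, LittleQLegendre.explicitConst_pos hq0 hq1,
      fun n => ⟨?_, ?_, hup n⟩⟩,
    (summable_nat_add_iff 1).2 (LittleQLegendre.summable_seriesTerm hq0 hq1),
    LittleQLegendre.explicitConst_pos hq0 hq1, hup⟩
  · rw [LittleQLegendre.normP_two_sq hq0 hq1]
    positivity
  · rw [LittleQLegendre.normP_one hq0 hq1, LittleQLegendre.normP_two_sq hq0 hq1]
    exact div_lt_div_of_pos_right (LittleQLegendre.tsum_wt_mul_sq_lt hq0 hq1 n) hq
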